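/- Let $p>3$ be a prime. For a nonnegative integer $k$ let $\binom{-1/3}{k}=\frac{1}{k!}\prod_{i=0}^{k-1}\left(-\frac13-i\right)$, and let $[x]$ denote the greatest integer not exceeding $x$. Congruences modulo $p$ are between rational numbers whose denominators are coprime to $p$ (in particular, all the sums below are of this kind), and $x\equiv y\pmod p$ means that $(x-y)/p$ has denominator coprime to $p$. Then $$\sum_{k=0}^{p-1}\binom{-\frac13}{k}^2 9^k\;\equiv\;\frac{1}{3^{[p/3]}}\sum_{k=0}^{p-1}\binom{-\frac13}{k}^2\frac{1}{9^k}\pmod p .$$ Moreover: - if $p\equiv 1\pmod 3$ and $L,M$ are integers with $4p=L^2+27M^2$ and $3\mid L-2$, then both sides are congruent to $L$ modulo $p$; - if $p\equiv 2\pmod 3$, then both sides are congruent to $0$ modulo $p$. -/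

import Mathlib

/-- The rational number `x` is `p`-integral: its reduced denominator is coprime to `p`. -/
def IsPIntegral (p : ℕ) (x : ℚ) : Prop :=
  Nat.Coprime x.den p

/-- The congruence `x ≡ y (mod p)` in the ring of `p`-integral rational numbers: both sides are
`p`-integral, and their difference is `p` times a `p`-integral rational number. -/
def RatModEq (p : ℕ) (x y : ℚ) : Prop :=
  IsPIntegral p x ∧ IsPIntegral p y ∧ ∃ z : ℚ, IsPIntegral p z ∧ x - y = (p : ℚ) * z

/-!
Let `n < p` be the natural number with `3 n ≡ -1 (mod p)`, so that `binom(-1/3, k)` reduces to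
`n.choose k` for `k < p`, and let `S(x) = ∑ (n.choose k) ^ 2 * x ^ k` over `𝔽_p`. Reversing the sum
gives `S(9) = 9 ^ n * S(1/9)`, which relates the two sides of the theorem; everything else is the
evaluation of `S(9)`.

The value `S(9)` is, up to the factor `-8 ^ n`, the number of points off the cubic cone
`x ^ 3 + y ^ 3 + z ^ 3 + 6 x y z = 0`, counted in `𝔽_p` as the sum `W` of the `(p - 1)`-st powers of
this form over `𝔽_p ^ 3` (`sum_choose_sq_mul_nine_pow`). On the one hand
`S(y + 1) = ∑ (n.choose k) * ((n + k).choose k) * y ^ (n - k)` and, modulo `p`,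
`(n.choose k) * ((n + k).choose k) = (-1/27) ^ k * (3 k)! / k! ^ 3`; on the other hand expanding `W`
leaves only the coefficient of `(x y z) ^ (p - 1)`, which is the same sum of `(3 k)! / k! ^ 3`.

The member of the Hesse pencil with parameter `6` is special: the substitution
`(x, y, z) = (t + a, t + b, t - a - b)` turns it into `9 (t ^ 3 - a b (a + b))`. If `p ≡ 2 (mod 3)`,
cubing is a bijection of `𝔽_p`, so the cone has exactly `p ^ 2` points and `W = 0`. If
`p = 3 n + 1`, summing over `t` and using homogeneity in `(a, b)` gives
`W = ∑ (s (1 - s)) ^ n + ∑ (s (1 - s)) ^ (2 n)`, which is the residue of the trace `A` of the Jacobi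
sum `J(χ, χ)` of a cubic character. The norm of `J(χ, χ)` is `p` and `J(χ, χ) ≡ -1` modulo
`(ω - 1) ^ 2`, whence `4 p = A ^ 2 + 27 B ^ 2` and `A ≡ 1 (mod 3)`
(`exists_four_mul_prime_eq_sq_add`). Such a representation is unique up to signs, so `L = -A`
(`eq_neg_of_four_mul_prime_eq`), and `S(9) = -W = L`.
-/

/-! ### Power sums over a prime field -/

section PowerSums

variable {p : ℕ} [Fact p.Prime]

theorem ZMod.natCast_ne_zero_of_lt {m : ℕ} (h0 : 0 < m) (hm : m < p) : (m : ZMod p) ≠ 0 := by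
  rw [Ne, ZMod.natCast_eq_zero_iff]
  exact fun h => absurd (Nat.le_of_dvd h0 h) (not_le.2 hm)

theorem ZMod.two_ne_zero_of_three_lt (hp3 : 3 < p) : (2 : ZMod p) ≠ 0 := by
  exact_mod_cast ZMod.natCast_ne_zero_of_lt (p := p) (m := 2) (by omega) (by omega)

theorem ZMod.three_ne_zero_of_three_lt (hp3 : 3 < p) : (3 : ZMod p) ≠ 0 := by
  exact_mod_cast ZMod.natCast_ne_zero_of_lt (p := p) (m := 3) (by omega) (by omega)

theorem ZMod.natCast_choose_prime_sub_one {j : ℕ} (hj : j < p) :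
    (((p - 1).choose j : ℕ) : ZMod p) = (-1) ^ j := by
  have hp : p.Prime := Fact.out
  induction j with
  | zero => simp
  | succ j ih =>
    have h1 : p.choose (j + 1) = (p - 1).choose j + (p - 1).choose (j + 1) := by
      obtain ⟨m, rfl⟩ : ∃ m, p = m + 1 := ⟨p - 1, by have := hp.pos; omega⟩
      simp [Nat.choose_succ_succ]
    have h2 : ((p.choose (j + 1) : ℕ) : ZMod p) = 0 :=
      (ZMod.natCast_eq_zero_iff _ _).2 (hp.dvd_choose_self (by omega) hj)
    rw [h1, Nat.cast_add, ih (by omega)] at h2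
    rw [pow_succ]
    linear_combination h2

theorem ZMod.add_pow_prime_sub_one (x y : ZMod p) :
    (x + y) ^ (p - 1) = ∑ j ∈ Finset.range p, (-1) ^ j * x ^ j * y ^ (p - 1 - j) := by
  have hp : p.Prime := Fact.out
  rw [add_pow, Nat.sub_add_cancel hp.one_le]
  refine Finset.sum_congr rfl fun j hj => ?_
  rw [ZMod.natCast_choose_prime_sub_one (Finset.mem_range.1 hj)]
  ring

theorem ZMod.sum_pow_eq_ite (e : ℕ) :
    ∑ x : ZMod p, x ^ e = if e ≠ 0 ∧ p - 1 ∣ e then -1 else 0 := by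
  rcases eq_or_ne e 0 with rfl | he
  · simp
  have h := FiniteField.sum_pow_units (ZMod p) e
  rw [ZMod.card] at h
  have h2 : ∑ x : ZMod p, x ^ e = ∑ x : (ZMod p)ˣ, ((x : ZMod p) ^ e) := by
    rw [← Fintype.sum_subtype_add_sum_subtype (fun x : ZMod p => x ≠ 0)]
    have h3 : ∑ x : {x : ZMod p // ¬ x ≠ 0}, (x : ZMod p) ^ e = 0 :=
      Finset.sum_eq_zero fun x _ => by
        have := x.2
        rw [not_not] at this
        rw [this, zero_pow he]
    rw [h3, add_zero]
    exact (Fintype.sum_equiv unitsEquivNeZero _ _ fun x => rfl).symm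
  rw [h2]
  simpa [he] using h

/-- The only monomial of degree `3 (p - 1)` in three variables whose sum over `𝔽_p ^ 3` does not
vanish is `(x y z) ^ (p - 1)`. -/
theorem ZMod.sum_pow_mul_sum_pow_mul_sum_pow {a b c : ℕ} (h : a + b + c = 3 * (p - 1)) :
    (∑ x : ZMod p, x ^ a) * (∑ x : ZMod p, x ^ b) * (∑ x : ZMod p, x ^ c) =
      if a = p - 1 ∧ b = p - 1 then -1 else 0 := by
  have hp : p.Prime := Fact.out
  have h2 := hp.two_le
  have key : ∀ e : ℕ, e ≠ 0 → p - 1 ∣ e → p - 1 ≤ e := fun e he hd =>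
    Nat.le_of_dvd (Nat.pos_of_ne_zero he) hd
  simp only [ZMod.sum_pow_eq_ite]
  by_cases hab : a = p - 1 ∧ b = p - 1
  · obtain ⟨rfl, rfl⟩ := hab
    obtain rfl : c = p - 1 := by omega
    have : p - 1 ≠ 0 := by omega
    simp [this]
  · rw [if_neg hab]
    by_cases ha : a ≠ 0 ∧ p - 1 ∣ a
    · by_cases hb : b ≠ 0 ∧ p - 1 ∣ b
      · by_cases hc : c ≠ 0 ∧ p - 1 ∣ c
        · have := key a ha.1 ha.2
          have := key b hb.1 hb.2
          have := key c hc.1 hc.2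
          omega
        · rw [if_neg hc, mul_zero]
      · rw [if_neg hb, mul_zero, zero_mul]
    · rw [if_neg ha, zero_mul, zero_mul]

theorem add_pow_eq_sum_range {R : Type*} [CommSemiring R] (x y : R) {m N : ℕ} (h : m < N) :
    (x + y) ^ m = ∑ i ∈ Finset.range N, x ^ i * y ^ (m - i) * (m.choose i : R) := by
  rw [add_pow]
  refine Finset.sum_subset (Finset.range_subset_range.2 h) fun i _ hi => ?_
  rw [Nat.choose_eq_zero_of_lt (by simpa [Nat.succ_le_iff] using hi), Nat.cast_zero, mul_zero]

end PowerSums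

/-! ### The sum of powers of the Hesse cubic as a truncated hypergeometric sum -/

section Cubic

variable {p : ℕ} [Fact p.Prime]

/-- The `(p - 1)`-st power of the Hesse cubic as a sum of monomials. All three indices run over
`range p`, a superset of the support, so that the sums can be interchanged freely. -/
theorem hesse_pow_expand (x y z : ZMod p) :
    (x ^ 3 + y ^ 3 + z ^ 3 + 6 * x * y * z) ^ (p - 1) =
      ∑ m ∈ Finset.range p, ∑ i ∈ Finset.range p, ∑ l ∈ Finset.range p,
        (-1) ^ m * 6 ^ (p - 1 - m) * (m.choose i : ZMod p) * ((m - i).choose l : ZMod p) *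
          (x ^ (p - 1 - m + 3 * i) * y ^ (p - 1 - m + 3 * l) *
            z ^ (p - 1 - m + 3 * (m - i - l))) := by
  rw [ZMod.add_pow_prime_sub_one]
  refine Finset.sum_congr rfl fun m hm => ?_
  rw [add_assoc (x ^ 3), add_pow_eq_sum_range _ _ (Finset.mem_range.1 hm), Finset.mul_sum,
    Finset.sum_mul]
  refine Finset.sum_congr rfl fun i _ => ?_
  rw [add_pow_eq_sum_range (y ^ 3) _ ((Nat.sub_le m i).trans_lt (Finset.mem_range.1 hm)),
    Finset.mul_sum, Finset.sum_mul, Finset.mul_sum, Finset.sum_mul]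
  refine Finset.sum_congr rfl fun l _ => ?_
  simp only [pow_add, pow_mul, mul_pow]
  ring

theorem sum_sum_sum_monomial (c : ZMod p) (a b d : ℕ) :
    ∑ x : ZMod p, ∑ y : ZMod p, ∑ z : ZMod p, c * (x ^ a * y ^ b * z ^ d) =
      c * ((∑ x : ZMod p, x ^ a) * (∑ x : ZMod p, x ^ b) * (∑ x : ZMod p, x ^ d)) := by
  simp only [← Finset.mul_sum, ← Finset.sum_mul]

theorem choose_mul_choose_mul_factorial_pow (k : ℕ) :
    (3 * k).choose k * (2 * k).choose k * (k.factorial) ^ 3 = (3 * k).factorial := by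
  have e1 := Nat.choose_mul_factorial_mul_factorial (n := 3 * k) (k := k) (by omega)
  have e2 := Nat.choose_mul_factorial_mul_factorial (n := 2 * k) (k := k) (by omega)
  rw [show 3 * k - k = 2 * k by omega] at e1
  rw [show 2 * k - k = k by omega] at e2
  rw [← e1, ← e2]; ring

/-- The multinomial coefficient `(3 k)! / k! ^ 3` is divisible by `p` in the range where the
monomial with exponent `p - 1 - 3 k` is absent, so this range may be added to the sum. -/
theorem choose_mul_choose_eq_zero {k : ℕ} (hk : k < p) (h3 : p ≤ 3 * k) :
    (((3 * k).choose k : ℕ) : ZMod p) * ((2 * k).choose k : ℕ) = 0 := by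
  have hp : p.Prime := Fact.out
  have h2 : p ∣ (3 * k).choose k * (2 * k).choose k * (k.factorial) ^ 3 := by
    rw [choose_mul_choose_mul_factorial_pow]
    exact (hp.dvd_factorial).2 h3
  rw [← Nat.cast_mul, ZMod.natCast_eq_zero_iff]
  rcases (hp.dvd_mul).1 h2 with h | h
  · exact h
  · have := (hp.dvd_factorial).1 (hp.dvd_of_dvd_pow h)
    omega

/-- Summing over `𝔽_p ^ 3` extracts minus the coefficient of `(x y z) ^ (p - 1)`, to which the terms
`(x y z) ^ (p - 1 - 3 k) * (x ^ 3) ^ k * (y ^ 3) ^ k * (z ^ 3) ^ k` contribute. -/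
theorem sum_hesse_pow_eq (hp3 : 3 < p) :
    ∑ x : ZMod p, ∑ y : ZMod p, ∑ z : ZMod p,
        (x ^ 3 + y ^ 3 + z ^ 3 + 6 * x * y * z) ^ (p - 1) =
      -∑ k ∈ Finset.range p, (-1) ^ k * (((3 * k).choose k : ℕ) : ZMod p) *
        ((2 * k).choose k : ℕ) * ((216 : ZMod p)⁻¹) ^ k := by
  have hp : p.Prime := Fact.out
  have h6 : (6 : ZMod p) ≠ 0 := by
    rw [show (6 : ZMod p) = 2 * 3 by norm_num]
    exact mul_ne_zero (ZMod.two_ne_zero_of_three_lt hp3) (ZMod.three_ne_zero_of_three_lt hp3)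
  simp only [hesse_pow_expand]
  have swap : ∀ f : ℕ → ℕ → ℕ → ZMod p → ZMod p → ZMod p → ZMod p,
      (∑ x : ZMod p, ∑ y : ZMod p, ∑ z : ZMod p, ∑ m ∈ Finset.range p, ∑ i ∈ Finset.range p,
        ∑ l ∈ Finset.range p, f m i l x y z) =
      ∑ i ∈ Finset.range p, ∑ m ∈ Finset.range p, ∑ l ∈ Finset.range p,
        ∑ x : ZMod p, ∑ y : ZMod p, ∑ z : ZMod p, f m i l x y z := by
    intro f
    simp only [Finset.sum_comm (s := (Finset.univ : Finset (ZMod p))) (t := Finset.range p)]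
    rw [Finset.sum_comm]
  rw [swap, ← Finset.sum_neg_distrib]
  refine Finset.sum_congr rfl fun i hi => ?_
  have hi := Finset.mem_range.1 hi
  have term : ∀ m ∈ Finset.range p, ∀ l ∈ Finset.range p,
      (∑ x : ZMod p, ∑ y : ZMod p, ∑ z : ZMod p,
        (-1) ^ m * 6 ^ (p - 1 - m) * (m.choose i : ZMod p) * ((m - i).choose l : ZMod p) *
          (x ^ (p - 1 - m + 3 * i) * y ^ (p - 1 - m + 3 * l) *
            z ^ (p - 1 - m + 3 * (m - i - l)))) =
      if m = 3 * i then (if l = i then -((-1) ^ i * (((3 * i).choose i : ℕ) : ZMod p) *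
        ((2 * i).choose i : ℕ) * ((216 : ZMod p)⁻¹) ^ i) else 0) else 0 := by
    intro m hm l hl
    have hm := Finset.mem_range.1 hm
    rw [sum_sum_sum_monomial]
    by_cases him : i ≤ m
    swap
    · rw [Nat.choose_eq_zero_of_lt (not_le.1 him), if_neg (by omega)]
      simp
    by_cases hlm : l ≤ m - i
    swap
    · rw [Nat.choose_eq_zero_of_lt (not_le.1 hlm)]
      split_ifs <;> first | omega | simp
    rw [ZMod.sum_pow_mul_sum_pow_mul_sum_pow (by omega)]
    by_cases h1 : m = 3 * i
    · by_cases h2 : l = i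
      · rw [if_pos (by omega), if_pos h1, if_pos h2]
        subst h2
        have h216 : (6 : ZMod p) ^ (p - 1 - m) = ((216 : ZMod p)⁻¹) ^ l := by
          rw [inv_pow]
          refine eq_inv_of_mul_eq_one_left ?_
          rw [show (216 : ZMod p) = 6 ^ 3 by norm_num, ← pow_mul, ← pow_add,
            show p - 1 - m + 3 * l = p - 1 by omega]
          exact ZMod.pow_card_sub_one_eq_one h6
        rw [h216, h1, show 3 * l - l = 2 * l by omega, pow_mul,
          show (-1 : ZMod p) ^ 3 = -1 by norm_num]
        ring
      · rw [if_neg (by omega), if_pos h1, if_neg h2, mul_zero]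
    · rw [if_neg (by omega), if_neg h1, mul_zero]
  rw [Finset.sum_congr rfl fun m hm => Finset.sum_congr rfl fun l hl => term m hm l hl]
  by_cases h3 : 3 * i < p
  · rw [Finset.sum_eq_single (3 * i) (fun m _ h => by simp [h])
      (fun h => absurd (Finset.mem_range.2 h3) h)]
    simp [hi]
  · have h0 := choose_mul_choose_eq_zero hi (not_lt.1 h3)
    rw [mul_assoc ((-1 : ZMod p) ^ i), h0]
    simp

end Cubic

/-! ### Sums of squares of binomial coefficients -/

section Hypergeometric

open Polynomial in
/-- Both sides are the coefficient of `X ^ n` in `((1 + X) * (1 + (y + 1) * X)) ^ n`; for the right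
side the second factor is read as `(1 + X) + y * X`. -/
theorem sum_choose_sq_mul_add_one_pow {R : Type*} [CommRing R] (n : ℕ) (y : R) :
    ∑ k ∈ Finset.range (n + 1), (n.choose k : R) ^ 2 * (y + 1) ^ k =
      ∑ k ∈ Finset.range (n + 1), (n.choose k : R) * ((n + k).choose k : R) * y ^ (n - k) := by
  have hco : ∀ (c : R) (m : ℕ), ∀ k ∈ Finset.range (n + 1),
      ((C c * X ^ k * (1 + X) ^ m : R[X])).coeff n = c * (m.choose (n - k) : R) := by
    intro c m k hk
    rw [mul_assoc, coeff_C_mul, coeff_X_pow_mul', if_pos (by simpa [Nat.lt_succ_iff] using hk),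
      coeff_one_add_X_pow]
  have h1 : ((1 + X) * (1 + C (y + 1) * X) : R[X]) ^ n = ∑ k ∈ Finset.range (n + 1),
      C ((n.choose k : R) * (y + 1) ^ k) * X ^ k * (1 + X) ^ n := by
    rw [mul_pow, add_comm (1 : R[X]) (C (y + 1) * X), add_pow (C (y + 1) * X),
      Finset.mul_sum]
    refine Finset.sum_congr rfl fun k _ => ?_
    simp only [map_mul, map_pow, map_natCast, mul_pow, one_pow]
    ring
  have h2 : ((1 + X) * (1 + C (y + 1) * X) : R[X]) ^ n = ∑ k ∈ Finset.range (n + 1),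
      C ((n.choose k : R) * y ^ k) * X ^ k * (1 + X) ^ (n + (n - k)) := by
    rw [show ((1 + X) * (1 + C (y + 1) * X) : R[X]) = (1 + X) * (C y * X + (1 + X)) by
      simp only [map_add, map_one]; ring, mul_pow, add_pow (C y * X),
      Finset.mul_sum]
    refine Finset.sum_congr rfl fun k _ => ?_
    simp only [map_mul, map_pow, map_natCast, mul_pow, pow_add]
    ring
  have h3 := congrArg (fun f : R[X] => f.coeff n) (h1.symm.trans h2)
  simp only [finsetSum_coeff] at h3
  rw [Finset.sum_congr rfl fun k hk => hco _ _ k hk,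
    Finset.sum_congr (g := fun k => (n.choose k : R) * y ^ k * ((n + (n - k)).choose (n - k) : R))
      rfl fun k hk => hco _ _ k hk] at h3
  have e1 : ∑ k ∈ Finset.range (n + 1), (n.choose k : R) ^ 2 * (y + 1) ^ k =
      ∑ k ∈ Finset.range (n + 1),
        (n.choose k : R) * (y + 1) ^ k * (n.choose (n - k) : R) := by
    refine Finset.sum_congr rfl fun k hk => ?_
    rw [Nat.choose_symm (by simpa [Nat.lt_succ_iff] using hk)]
    ring
  rw [e1, h3, ← Finset.sum_range_reflect]
  refine Finset.sum_congr rfl fun k hk => ?_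
  have hk : k ≤ n := by simpa [Nat.lt_succ_iff] using hk
  rw [show n + 1 - 1 - k = n - k by omega, Nat.choose_symm hk, show n - (n - k) = k by omega]
  ring

theorem choose_three_mul_succ (k : ℕ) :
    (k + 1) ^ 2 * ((3 * (k + 1)).choose (k + 1) * (2 * (k + 1)).choose (k + 1)) =
      3 * (3 * k + 1) * (3 * k + 2) * ((3 * k).choose k * (2 * k).choose k) := by
  have h1 := choose_mul_choose_mul_factorial_pow (k + 1)
  rw [show 3 * (k + 1) = 3 * k + 2 + 1 by ring, Nat.factorial_succ (3 * k + 2),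
    Nat.factorial_succ (3 * k + 1), Nat.factorial_succ (3 * k),
    ← choose_mul_choose_mul_factorial_pow k, Nat.factorial_succ k] at h1
  refine Nat.eq_of_mul_eq_mul_right (pow_pos k.factorial_pos 3)
    (Nat.eq_of_mul_eq_mul_left (show 0 < k + 1 by omega) ?_)
  rw [show 3 * (k + 1) = 3 * k + 2 + 1 by ring]
  linear_combination h1

theorem natCast_choose_succ_mul {R : Type*} [CommRing R] (n k : ℕ) :
    (n.choose (k + 1) : R) * (k + 1) = n.choose k * (n - k) := by
  rcases le_or_gt k n with h | h
  · have := congrArg (Nat.cast (R := R)) (Nat.choose_succ_right_eq n k)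
    push_cast [h] at this
    exact this
  · rw [Nat.choose_eq_zero_of_lt h, Nat.choose_eq_zero_of_lt (by omega)]
    simp

variable {p : ℕ} [Fact p.Prime]

/-- For `n ≡ -1/3`, the two sides satisfy the same recurrence in `k`, since
`9 (n - k) (n + k + 1) ≡ -(3 k + 1) (3 k + 2)`. -/
theorem choose_mul_choose_add {n k : ℕ} (hn : (3 : ZMod p) * n = -1) (hk : k < p) :
    27 ^ k * ((n.choose k : ZMod p) * ((n + k).choose k : ZMod p)) =
      (-1) ^ k * ((((3 * k).choose k : ℕ) : ZMod p) * ((2 * k).choose k : ℕ)) := by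
  induction k with
  | zero => simp
  | succ k ih =>
    have ih := ih (by omega)
    have hk0 : ((k : ZMod p) + 1) ≠ 0 := by
      exact_mod_cast ZMod.natCast_ne_zero_of_lt k.succ_pos hk
    have h1 := natCast_choose_succ_mul (R := ZMod p) n k
    have h2 : ((n + (k + 1)).choose (k + 1) : ZMod p) * (k + 1) =
        (n + k + 1) * ((n + k).choose k : ZMod p) := by
      have := congrArg (Nat.cast (R := ZMod p)) (Nat.add_one_mul_choose_eq (n + k) k)
      push_cast at this
      exact this.symm
    have h3 := congrArg (Nat.cast (R := ZMod p)) (choose_three_mul_succ k)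
    push_cast at h3
    refine mul_left_cancel₀ (pow_ne_zero 2 hk0) ?_
    have hq : (9 : ZMod p) * ((n - k) * (n + k + 1)) = -((3 * k + 1) * (3 * k + 2)) := by
      linear_combination (3 * (n : ZMod p) + 2) * hn
    calc ((k : ZMod p) + 1) ^ 2 * (27 ^ (k + 1) *
          ((n.choose (k + 1) : ZMod p) * ((n + (k + 1)).choose (k + 1) : ZMod p)))
        = 27 ^ (k + 1) * (((n.choose (k + 1) : ZMod p) * (k + 1)) *
          (((n + (k + 1)).choose (k + 1) : ZMod p) * (k + 1))) := by ring
      _ = 3 * (9 * ((n - k) * (n + k + 1))) *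
          (27 ^ k * ((n.choose k : ZMod p) * ((n + k).choose k : ZMod p))) := by
          rw [h1, h2]; ring
      _ = (-1) ^ (k + 1) * (3 * (3 * (k : ZMod p) + 1) * (3 * k + 2) *
          ((((3 * k).choose k : ℕ) : ZMod p) * ((2 * k).choose k : ℕ))) := by
          rw [hq, ih]; ring
      _ = _ := by rw [← h3]; ring

theorem sum_range_choose_extend {n : ℕ} (hn : n < p) (f : ℕ → ZMod p)
    (hf : ∀ k, n < k → f k = 0) :
    ∑ k ∈ Finset.range p, f k = ∑ k ∈ Finset.range (n + 1), f k :=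
  (Finset.sum_subset (Finset.range_subset_range.2 hn) fun k _ hk =>
    hf k (by simpa [Nat.succ_le_iff] using hk)).symm

theorem sum_choose_sq_mul_nine_pow {n : ℕ} (hp3 : 3 < p) (hnp : n < p)
    (hn : (3 : ZMod p) * n = -1) :
    ∑ k ∈ Finset.range p, (n.choose k : ZMod p) ^ 2 * 9 ^ k =
      -8 ^ n * ∑ x : ZMod p, ∑ y : ZMod p, ∑ z : ZMod p,
        (x ^ 3 + y ^ 3 + z ^ 3 + 6 * x * y * z) ^ (p - 1) := by
  have h3 := ZMod.three_ne_zero_of_three_lt hp3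
  have h2 := ZMod.two_ne_zero_of_three_lt hp3
  have h27 : (27 : ZMod p) ≠ 0 := by
    rw [show (27 : ZMod p) = 3 ^ 3 by norm_num]; exact pow_ne_zero _ h3
  have h8 : (8 : ZMod p) ≠ 0 := by
    rw [show (8 : ZMod p) = 2 ^ 3 by norm_num]; exact pow_ne_zero _ h2
  have h216 : (216 : ZMod p)⁻¹ = 27⁻¹ * 8⁻¹ := by
    rw [← mul_inv]; norm_num
  rw [sum_hesse_pow_eq hp3, neg_mul_neg,
    sum_range_choose_extend hnp _ (fun k hk => by rw [Nat.choose_eq_zero_of_lt hk]; simp)]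
  have hS := sum_choose_sq_mul_add_one_pow n (8 : ZMod p)
  rw [show (8 : ZMod p) + 1 = 9 by norm_num] at hS
  rw [hS]
  have key : ∀ k < p, (-1) ^ k * (((3 * k).choose k : ℕ) : ZMod p) *
      ((2 * k).choose k : ℕ) * ((216 : ZMod p)⁻¹) ^ k =
      (n.choose k : ZMod p) * ((n + k).choose k : ZMod p) * (8⁻¹) ^ k := by
    intro k hk
    rw [mul_assoc ((-1 : ZMod p) ^ k), ← choose_mul_choose_add hn hk, h216, mul_pow, inv_pow 27]
    field_simp
  rw [Finset.sum_congr rfl fun k hk => key k (Finset.mem_range.1 hk),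
    sum_range_choose_extend hnp _ (fun k hk => by rw [Nat.choose_eq_zero_of_lt hk]; simp),
    Finset.mul_sum]
  refine Finset.sum_congr rfl fun k hk => ?_
  have hk : k ≤ n := by simpa [Nat.lt_succ_iff] using hk
  rw [pow_sub₀ _ h8 hk, inv_pow]
  ring

theorem sum_choose_sq_mul_pow_reverse {n : ℕ} (hnp : n < p) {a : ZMod p} (ha : a ≠ 0) :
    ∑ k ∈ Finset.range p, (n.choose k : ZMod p) ^ 2 * a ^ k =
      a ^ n * ∑ k ∈ Finset.range p, (n.choose k : ZMod p) ^ 2 * (a ^ k)⁻¹ := by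
  rw [sum_range_choose_extend hnp _ (fun k hk => by rw [Nat.choose_eq_zero_of_lt hk]; simp),
    sum_range_choose_extend hnp _ (fun k hk => by rw [Nat.choose_eq_zero_of_lt hk]; simp),
    ← Finset.sum_range_reflect, Finset.mul_sum]
  refine Finset.sum_congr rfl fun k hk => ?_
  have hk : k ≤ n := by simpa [Nat.lt_succ_iff] using hk
  rw [show n + 1 - 1 - k = n - k by omega, Nat.choose_symm hk, pow_sub₀ _ ha hk]
  ring

end Hypergeometric

/-! ### Evaluation of the Hesse cubic by a linear change of variables -/

section CubicPoints

variable {p : ℕ} [Fact p.Prime]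

/-- The substitution `(x, y, z) = (t + a, t + b, t - a - b)`, invertible as `p ≠ 3`, turns the form
`x ^ 3 + y ^ 3 + z ^ 3 + 6 x y z` into `9 (t ^ 3 - a b (a + b))`. -/
theorem sum_hesse_pow_change_variables (hp3 : 3 < p) :
    ∑ x : ZMod p, ∑ y : ZMod p, ∑ z : ZMod p,
        (x ^ 3 + y ^ 3 + z ^ 3 + 6 * x * y * z) ^ (p - 1) =
      ∑ a : ZMod p, ∑ b : ZMod p, ∑ t : ZMod p, (t ^ 3 - a * b * (a + b)) ^ (p - 1) := by
  have h3 := ZMod.three_ne_zero_of_three_lt hp3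
  let e : ZMod p × ZMod p × ZMod p ≃ ZMod p × ZMod p × ZMod p :=
    { toFun := fun v => (v.2.2 + v.1, v.2.2 + v.2.1, v.2.2 - v.1 - v.2.1)
      invFun := fun v => (v.1 - (v.1 + v.2.1 + v.2.2) / 3, v.2.1 - (v.1 + v.2.1 + v.2.2) / 3,
        (v.1 + v.2.1 + v.2.2) / 3)
      left_inv := by
        rintro ⟨a, b, t⟩
        ext <;> simp only <;> field_simp <;> ring
      right_inv := by
        rintro ⟨x, y, z⟩
        ext <;> simp only <;> field_simp <;> ring }
  have h := Fintype.sum_equiv e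
    (fun v => (v.2.2 ^ 3 - v.1 * v.2.1 * (v.1 + v.2.1)) ^ (p - 1))
    (fun v => (v.1 ^ 3 + v.2.1 ^ 3 + v.2.2 ^ 3 + 6 * v.1 * v.2.1 * v.2.2) ^ (p - 1)) (by
      rintro ⟨a, b, t⟩
      have h9 : (9 : ZMod p) ^ (p - 1) = 1 := ZMod.pow_card_sub_one_eq_one (by
        rw [show (9 : ZMod p) = 3 ^ 2 by norm_num]; exact pow_ne_zero _ h3)
      simp only [e, Equiv.coe_fn_mk]
      rw [← one_mul ((t ^ 3 - a * b * (a + b)) ^ (p - 1)), ← h9, ← mul_pow]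
      congr 1
      ring)
  simp only [Fintype.sum_prod_type] at h
  exact h.symm

/-- Cubing is bijective on `𝔽_p`, so the sum over `t` does not depend on `a` and `b`. -/
theorem sum_hesse_pow_of_mod_three_eq_two (hp3 : 3 < p) (h : p % 3 = 2) :
    ∑ x : ZMod p, ∑ y : ZMod p, ∑ z : ZMod p,
        (x ^ 3 + y ^ 3 + z ^ 3 + 6 * x * y * z) ^ (p - 1) = 0 := by
  rw [sum_hesse_pow_change_variables hp3]
  have hinj : Function.Injective fun t : ZMod p => t ^ 3 := by
    -- Since `2 p - 1 ≡ 1 (mod p - 1)`, raising to the power `(2 p - 1) / 3` inverts cubing.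
    have hinv : ∀ t : ZMod p, (t ^ 3) ^ ((2 * p - 1) / 3) = t := by
      intro t
      rw [← pow_mul, show 3 * ((2 * p - 1) / 3) = p + (p - 1) by omega, pow_add, ZMod.pow_card,
        ← pow_succ', Nat.sub_add_cancel (by omega), ZMod.pow_card]
    intro s t hst
    rw [← hinv s, ← hinv t]
    exact congrArg (· ^ ((2 * p - 1) / 3)) hst
  have hb : Function.Bijective fun t : ZMod p => t ^ 3 := Finite.injective_iff_bijective.1 hinj
  have hc : ∀ c : ZMod p, ∑ t : ZMod p, (t ^ 3 - c) ^ (p - 1) = ∑ t : ZMod p, t ^ (p - 1) := by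
    intro c
    rw [hb.sum_comp fun u => (u - c) ^ (p - 1)]
    exact (Equiv.subRight c).sum_comp fun u => u ^ (p - 1)
  simp [hc]

theorem sum_cube_sub_pow {n : ℕ} (hpn : p = 3 * n + 1) (c : ZMod p) :
    ∑ t : ZMod p, (t ^ 3 - c) ^ (p - 1) = -(1 + c ^ n + c ^ (2 * n)) := by
  have hp : p.Prime := Fact.out
  have hn0 : n ≠ 0 := by rintro rfl; exact hp.ne_one hpn
  have hev : Even (3 * n) := by
    have := hp.eq_two_or_odd
    rw [Nat.even_iff]; omega
  simp only [sub_eq_add_neg, ZMod.add_pow_prime_sub_one]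
  rw [Finset.sum_comm]
  have term : ∀ j ∈ Finset.range p, ∑ t : ZMod p, (-1) ^ j * (t ^ 3) ^ j * (-c) ^ (p - 1 - j) =
      c ^ (3 * n - j) * ∑ t : ZMod p, t ^ (3 * j) := by
    intro j hj
    have hj := Finset.mem_range.1 hj
    rw [Finset.mul_sum]
    refine Finset.sum_congr rfl fun t _ => ?_
    rw [show p - 1 - j = 3 * n - j by omega, neg_pow c, ← pow_mul]
    have : (-1 : ZMod p) ^ j * (-1) ^ (3 * n - j) = 1 := by
      rw [← pow_add, show j + (3 * n - j) = 3 * n by omega, hev.neg_one_pow]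
    linear_combination (t ^ (3 * j) * c ^ (3 * n - j)) * this
  rw [Finset.sum_congr rfl term]
  -- Only the exponents `3 j` that are positive multiples of `p - 1 = 3 n` contribute.
  have hsub : ({n, 2 * n, 3 * n} : Finset ℕ) ⊆ Finset.range p := by
    intro j hj
    simp only [Finset.mem_insert, Finset.mem_singleton] at hj
    rw [Finset.mem_range]; omega
  rw [← Finset.sum_subset hsub]
  · have hs : ∀ m, m ≠ 0 → ∑ t : ZMod p, t ^ (3 * (m * n)) = -1 := by
      intro m hm
      rw [ZMod.sum_pow_eq_ite, if_pos]
      refine ⟨by positivity, ⟨m, ?_⟩⟩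
      rw [hpn, Nat.add_sub_cancel]; ring
    rw [Finset.sum_insert (by simp; omega), Finset.sum_insert (by simp; omega),
      Finset.sum_singleton, hs 2 two_ne_zero, hs 3 three_ne_zero]
    have h1 := hs 1 one_ne_zero
    rw [one_mul] at h1
    rw [h1, show 3 * n - n = 2 * n by omega, show 3 * n - 2 * n = n by omega, Nat.sub_self]
    ring
  · intro j hj hj'
    rw [ZMod.sum_pow_eq_ite, if_neg, mul_zero]
    rintro ⟨h0, q, hq⟩
    have hj := Finset.mem_range.1 hj
    rw [hpn, Nat.add_sub_cancel, mul_assoc] at hq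
    have hq : j = n * q := by omega
    simp only [Finset.mem_insert, Finset.mem_singleton, not_or] at hj'
    have hq4 : q < 4 := by
      by_contra h
      have := Nat.mul_le_mul_left n (not_lt.1 h)
      omega
    interval_cases q <;> omega

/-- By homogeneity the sum over `b` scales with `a ^ (3 m)`; substitute `b = -a s`. -/
theorem sum_sum_pow_binary_cubic {m : ℕ} (hm : m ≠ 0) (hd : p - 1 ∣ 3 * m) (he : Even m) :
    ∑ a : ZMod p, ∑ b : ZMod p, (a * b * (a + b)) ^ m = -∑ s : ZMod p, (s * (1 - s)) ^ m := by
  have h1 : ∀ a : ZMod p, ∑ b : ZMod p, (a * b * (a + b)) ^ m =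
      a ^ (3 * m) * ∑ s : ZMod p, (s * (1 - s)) ^ m := by
    intro a
    rcases eq_or_ne a 0 with rfl | ha
    · simp [hm]
    · rw [← Equiv.sum_comp (Equiv.mulLeft₀ (-a) (neg_ne_zero.2 ha)), Finset.mul_sum]
      refine Finset.sum_congr rfl fun s _ => ?_
      rw [Equiv.mulLeft₀_apply, pow_mul, ← mul_pow,
        show a * (-a * s) * (a + -a * s) = -(a ^ 3 * (s * (1 - s))) by ring, he.neg_pow]
  simp only [h1]
  rw [← Finset.sum_mul, ZMod.sum_pow_eq_ite, if_pos ⟨by omega, hd⟩, neg_one_mul]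

theorem sum_hesse_pow_of_eq_three_mul_add_one {n : ℕ} (hpn : p = 3 * n + 1) :
    ∑ x : ZMod p, ∑ y : ZMod p, ∑ z : ZMod p,
        (x ^ 3 + y ^ 3 + z ^ 3 + 6 * x * y * z) ^ (p - 1) =
      ∑ s : ZMod p, (s * (1 - s)) ^ n + ∑ s : ZMod p, (s * (1 - s)) ^ (2 * n) := by
  have hp : p.Prime := Fact.out
  have h2 := hp.eq_two_or_odd
  have hn0 : n ≠ 0 := by rintro rfl; exact hp.ne_one hpn
  have hev : Even n := by
    rw [Nat.even_iff]; omega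
  rw [sum_hesse_pow_change_variables (by omega)]
  simp only [sum_cube_sub_pow hpn, Finset.sum_neg_distrib, Finset.sum_add_distrib]
  rw [sum_sum_pow_binary_cubic hn0 ⟨1, by omega⟩ hev,
    sum_sum_pow_binary_cubic (by omega) ⟨2, by omega⟩ (hev.mul_left 2)]
  simp
  ring

end CubicPoints

/-! ### The cubic Jacobi sum and the representation `4 p = L ^ 2 + 27 M ^ 2` -/

section CubicJacobiSum

/-- The integers `x` and `y` serve all characters `f` of order three at once, complex-valued or with
values in `F`. This is what links the complex Jacobi sum to power sums in `ZMod p`. -/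
theorem exists_int_add_mul_of_mem_powers {F : Type} [Field F] {g u : F}
    (hu : u = 0 ∨ ∃ k : ℕ, u = g ^ k) :
    ∃ x y : ℤ, ∀ (K : Type) [Field K] (f : F →* K), f 0 = 0 → f g ^ 2 + f g + 1 = 0 →
      f u = x + y * f g := by
  rcases hu with rfl | ⟨k, rfl⟩
  · exact ⟨0, 0, fun K _ f h0 _ => by simp [h0]⟩
  · induction k with
    | zero => exact ⟨1, 0, fun K _ f _ _ => by simp⟩
    | succ k ih =>
      obtain ⟨x, y, h⟩ := ih
      refine ⟨-y, x - y, fun K _ f h0 hg => ?_⟩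
      rw [pow_succ, map_mul, h K f h0 hg]
      push_cast
      linear_combination (y : K) * hg

theorem exists_int_add_mul_of_mem_adjoin {ω z : ℂ} (hω : ω ^ 2 + ω + 1 = 0)
    (hz : z ∈ Algebra.adjoin ℤ {ω}) : ∃ a b : ℤ, z = a + b * ω := by
  induction hz using Algebra.adjoin_induction with
  | mem x hx => exact ⟨0, 1, by rw [Set.mem_singleton_iff.1 hx]; simp⟩
  | algebraMap r => exact ⟨r, 0, by simp⟩
  | add x y _ _ hx hy =>
    obtain ⟨a, b, rfl⟩ := hx
    obtain ⟨c, d, rfl⟩ := hy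
    exact ⟨a + c, b + d, by push_cast; ring⟩
  | mul x y _ _ hx hy =>
    obtain ⟨a, b, rfl⟩ := hx
    obtain ⟨c, d, rfl⟩ := hy
    exact ⟨a * c - b * d, a * d + b * c - b * d, by
      push_cast; linear_combination (b : ℂ) * d * hω⟩

theorem int_add_mul_eq_zero {ω : ℂ} (hω : ω ^ 2 + ω + 1 = 0) {a b : ℤ}
    (h : (a : ℂ) + b * ω = 0) : a = 0 ∧ b = 0 := by
  have h1 : ((a ^ 2 - a * b + b ^ 2 : ℤ) : ℂ) = 0 := by
    push_cast
    linear_combination ((a : ℂ) - b - b * ω) * h + (b : ℂ) ^ 2 * hω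
  have h2 : a ^ 2 - a * b + b ^ 2 = 0 := by exact_mod_cast h1
  constructor
  · nlinarith [sq_nonneg (a - 2 * b), sq_nonneg a]
  · nlinarith [sq_nonneg (2 * a - b), sq_nonneg b]

theorem sq_add_self_add_one_eq_zero {K : Type*} [Field K] {w : K} (h3 : w ^ 3 = 1) (h1 : w ≠ 1) :
    w ^ 2 + w + 1 = 0 := by
  refine (mul_eq_zero.1 ?_).resolve_left (sub_ne_zero.2 h1)
  linear_combination h3

variable {p : ℕ} [Fact p.Prime]

/-- The integer `A` is the trace `2 X - Y` of the Jacobi sum `J(χ, χ) = X + Y ω` of a cubic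
character `χ`. The same integers `X` and `Y` express the power sums in `ZMod p`, where
`u ↦ u ^ n` and `u ↦ u ^ (2 n)` play the role of `χ` and its conjugate. -/
theorem exists_four_mul_prime_eq_sq_add {n : ℕ} (hpn : p = 3 * n + 1) :
    ∃ A B : ℤ, 4 * (p : ℤ) = A ^ 2 + 27 * B ^ 2 ∧ 3 ∣ A - 1 ∧
      (A : ZMod p) =
        ∑ s : ZMod p, (s * (1 - s)) ^ n + ∑ s : ZMod p, (s * (1 - s)) ^ (2 * n) := by
  classical
  have hp : p.Prime := Fact.out
  have hn0 : n ≠ 0 := by rintro rfl; exact hp.ne_one hpn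
  have hcard : Fintype.card (ZMod p) - 1 = 3 * n := by rw [ZMod.card]; omega
  obtain ⟨g, hg⟩ := IsCyclic.exists_monoid_generator (α := (ZMod p)ˣ)
  have hrep : ∀ u : ZMod p, u = 0 ∨ ∃ k : ℕ, u = (g : ZMod p) ^ k := by
    intro u
    rcases eq_or_ne u 0 with h | h
    · exact Or.inl h
    · obtain ⟨k, hk⟩ := hg (Units.mk0 u h)
      refine Or.inr ⟨k, ?_⟩
      have := congrArg Units.val hk
      simpa using this.symm
  have hgz : ∀ x, x ∈ Subgroup.zpowers g := fun x => by
    obtain ⟨k, hk⟩ := hg x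
    exact ⟨k, by simpa using hk⟩
  obtain ⟨χ, hχ⟩ := MulChar.exists_mulChar_orderOf (ZMod p) (R := ℂ) (n := 3)
    ⟨n, hcard⟩ (Complex.isPrimitiveRoot_exp 3 three_ne_zero)
  have hχ3 : χ ^ 3 = 1 := hχ ▸ pow_orderOf_eq_one χ
  have hχ1 : χ ≠ 1 := by rintro rfl; simp at hχ
  have hχ2 : χ * χ ≠ 1 := by
    intro h
    rw [pow_succ, sq, h, one_mul] at hχ3
    exact hχ1 hχ3
  set ω : ℂ := χ g with hωdef
  have hω1 : ω ≠ 1 := fun h => hχ1 ((MulChar.eq_iff hgz χ 1).2 (by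
    rw [← hωdef, h, MulChar.one_apply_coe]))
  have hω3 : ω ^ 3 = 1 := by
    rw [hωdef, ← MulChar.pow_apply_coe, hχ3, MulChar.one_apply_coe]
  have hω := sq_add_self_add_one_eq_zero hω3 hω1
  have hprim : IsPrimitiveRoot ω 3 := by
    have h := IsPrimitiveRoot.orderOf ω
    rwa [orderOf_eq_prime hω3 hω1] at h
  have hinv : χ⁻¹ (g : ZMod p) = -1 - ω := by
    rw [MulChar.inv_apply_eq_inv', ← hωdef]
    refine inv_eq_of_mul_eq_one_right ?_
    linear_combination -hω
  have hw3 : ((g : ZMod p) ^ n) ^ 3 = 1 := by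
    rw [← pow_mul, mul_comm, ← hcard, ZMod.card]
    exact ZMod.pow_card_sub_one_eq_one g.ne_zero
  have hw1 : (g : ZMod p) ^ n ≠ 1 := by
    intro h
    have h1 : g ^ n = 1 := Units.ext (by simpa using h)
    have h2 := orderOf_dvd_of_pow_eq_one h1
    rw [orderOf_eq_card_of_forall_mem_zpowers hgz, Nat.card_eq_fintype_card, ZMod.card_units] at h2
    have := Nat.le_of_dvd (Nat.pos_of_ne_zero hn0) h2
    omega
  set w : ZMod p := (g : ZMod p) ^ n with hwdef
  have hw := sq_add_self_add_one_eq_zero hw3 hw1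
  choose x y hxy using fun u : ZMod p => exists_int_add_mul_of_mem_powers (hrep u)
  set X := ∑ s : ZMod p, x (s * (1 - s))
  set Y := ∑ s : ZMod p, y (s * (1 - s))
  have hsum : ∀ (K : Type) [Field K] (f : ZMod p →* K), f 0 = 0 → f g ^ 2 + f g + 1 = 0 →
      ∑ s : ZMod p, f (s * (1 - s)) = X + Y * f g := by
    intro K _ f h0 hf
    rw [Finset.sum_congr rfl fun s _ => hxy (s * (1 - s)) K f h0 hf, Finset.sum_add_distrib,
      ← Finset.sum_mul, Int.cast_sum, Int.cast_sum]
  have hJ : jacobiSum χ χ = X + Y * ω := by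
    have := hsum ℂ χ.toMonoidHom (MulChar.map_zero χ) hω
    rw [jacobiSum]
    simp only [← map_mul]
    exact this
  have hJ' : jacobiSum χ⁻¹ χ⁻¹ = X + Y * (-1 - ω) := by
    rw [← hinv]
    have := hsum ℂ (χ⁻¹).toMonoidHom (MulChar.map_zero χ⁻¹) (by
      change (χ⁻¹ (g : ZMod p)) ^ 2 + χ⁻¹ (g : ZMod p) + 1 = 0
      rw [hinv]; linear_combination hω)
    rw [jacobiSum]
    simp only [← map_mul]
    exact this
  have hnorm : X ^ 2 - X * Y + Y ^ 2 = (p : ℤ) := by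
    have h := jacobiSum_mul_jacobiSum_inv (F := ZMod p) (F' := ℂ) (by
      rw [ringChar.eq_zero, ZMod.ringChar_zmod_n]
      exact hp.ne_zero.symm) hχ1 hχ1 hχ2
    rw [hJ, hJ', ZMod.card] at h
    have h' : ((X ^ 2 - X * Y + Y ^ 2 : ℤ) : ℂ) = ((p : ℤ) : ℂ) := by
      push_cast
      linear_combination h + (Y : ℂ) ^ 2 * hω
    exact_mod_cast h'
  obtain ⟨z, hz, hJz⟩ := exists_jacobiSum_eq_neg_one_add (n := 3) (by norm_num) hχ3 hχ3
    ⟨n, hcard⟩ hprim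
  obtain ⟨a, b, rfl⟩ := exists_int_add_mul_of_mem_adjoin hω hz
  rw [hJ] at hJz
  -- As `(ω - 1) ^ 2 = -3 ω`, the Jacobi sum is `-1 - 3 ω (a + b ω) = (3 b - 1) + (3 b - 3 a) ω`.
  have hXY := int_add_mul_eq_zero hω (a := X - (3 * b - 1)) (b := Y - (3 * b - 3 * a)) (by
    push_cast
    linear_combination hJz + ((a : ℂ) + b * ω - 3 * b) * hω)
  have hX : X = 3 * b - 1 := by linarith [hXY.1]
  have hY : Y = 3 * b - 3 * a := by linarith [hXY.2]
  refine ⟨2 * X - Y, b - a, ?_, ⟨b + a - 1, by rw [hX, hY]; ring⟩, ?_⟩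
  · rw [← hnorm, hX, hY]; ring
  · have h1 := hsum (ZMod p) (powMonoidHom n) (by simp [hn0]) hw
    have h2 := hsum (ZMod p) (powMonoidHom (2 * n)) (by simp [hn0]) (by
      simp only [powMonoidHom_apply]
      rw [mul_comm 2 n, pow_mul, ← hwdef]
      linear_combination (w ^ 2 - w + 1) * hw)
    simp only [powMonoidHom_apply] at h1 h2
    rw [h1, h2, mul_comm 2 n, pow_mul, ← hwdef]
    push_cast
    linear_combination -(Y : ZMod p) * hw

/-- Uniqueness of the representation `4 p = L ^ 2 + 27 M ^ 2`, with the sign fixed modulo `3`. -/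
theorem eq_neg_of_four_mul_prime_eq {L M A B : ℤ} (h1 : 4 * (p : ℤ) = L ^ 2 + 27 * M ^ 2)
    (h2 : 4 * (p : ℤ) = A ^ 2 + 27 * B ^ 2) (hL : 3 ∣ L - 2) (hA : 3 ∣ A - 1) : L = -A := by
  have hp : p.Prime := Fact.out
  have hp0 : (0 : ℤ) < p := by exact_mod_cast hp.pos
  have key : ∀ A' : ℤ, 4 * (p : ℤ) = A' ^ 2 + 27 * B ^ 2 → (p : ℤ) ∣ L * B - A' * M →
      L * B - A' * M = 0 := by
    rintro A' hA' ⟨c, hc⟩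
    have h3 : (L * A' + 27 * M * B) ^ 2 + 27 * (p * c) ^ 2 = 16 * (p : ℤ) ^ 2 := by
      rw [← hc]
      linear_combination (-(A' ^ 2 + 27 * B ^ 2)) * h1 - 4 * (p : ℤ) * hA'
    -- Otherwise the second summand of `h3` is at least `27 p ^ 2`.
    have hc0 : c = 0 := by
      by_contra hc0
      have h4 : 1 ≤ c ^ 2 := Int.add_one_le_iff.2 (sq_pos_of_ne_zero hc0)
      nlinarith [sq_nonneg (L * A' + 27 * M * B), mul_pos hp0 hp0,
        mul_le_mul_of_nonneg_left h4 (sq_nonneg (p : ℤ))]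
    rw [hc, hc0, mul_zero]
  have hmul : (L * B - A * M) * (L * B + A * M) = p * (4 * (B ^ 2 - M ^ 2)) := by
    linear_combination M ^ 2 * h2 - B ^ 2 * h1
  -- Apply `key` to `A` or to `-A`, according to the factor divisible by `p`.
  have hprod : (L * B - A * M) * (L * B + A * M) = 0 := by
    rcases (Nat.prime_iff_prime_int.1 hp).dvd_or_dvd ⟨_, hmul⟩ with h | h
    · rw [key A h2 h, zero_mul]
    · have := key (-A) (by rw [neg_sq]; exact h2) (by simpa [sub_eq_add_neg] using h)
      rw [show L * B + A * M = 0 by linarith, mul_zero]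
  have hBM : B ^ 2 = M ^ 2 := by
    rw [hprod] at hmul
    rcases mul_eq_zero.1 hmul.symm with h | h <;> linarith
  have hLA : (L - A) * (L + A) = 0 := by linear_combination h2 - h1 + 27 * hBM
  rcases mul_eq_zero.1 hLA with h | h
  · omega
  · linarith

end CubicJacobiSum

/-! ### Reduction of rational numbers modulo `p` -/

section Reduction

/-- The rational number `x` is `p`-integral with residue `r`: it is a fraction of integers whose
denominator is prime to `p`, and the fraction reduces to `r` in `ZMod p`. Not fixing the
denominator makes compatibility with the ring operations immediate. -/
def HasResidue (p : ℕ) (x : ℚ) (r : ZMod p) : Prop :=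
  ∃ a b : ℤ, (b : ZMod p) ≠ 0 ∧ x * b = a ∧ (a : ZMod p) = r * b

variable {p : ℕ} [Fact p.Prime]

theorem isPIntegral_of_mul_eq {x : ℚ} {a b : ℤ} (hb : (b : ZMod p) ≠ 0) (h : x * b = a) :
    IsPIntegral p x := by
  have hp : p.Prime := Fact.out
  have hb0 : (b : ℚ) ≠ 0 := by
    intro h0
    have : b = 0 := by exact_mod_cast h0
    simp [this] at hb
  have hx : x = (a : ℚ) / b := (eq_div_iff hb0).2 h
  have hd : (x.den : ℤ) ∣ b := by
    rw [hx, ← Rat.divInt_eq_div]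
    exact Rat.den_dvd a b
  refine ((hp.coprime_iff_not_dvd).2 fun hpd => hb ?_).symm
  rw [ZMod.intCast_zmod_eq_zero_iff_dvd]
  exact (Int.natCast_dvd_natCast.2 hpd).trans hd

namespace HasResidue

theorem intCast (a : ℤ) : HasResidue p a (a : ZMod p) :=
  ⟨a, 1, by simp, by simp, by simp⟩

theorem add {x y : ℚ} {r s : ZMod p} (hx : HasResidue p x r) (hy : HasResidue p y s) :
    HasResidue p (x + y) (r + s) := by
  obtain ⟨a, b, hb, h1, h2⟩ := hx
  obtain ⟨c, d, hd, h3, h4⟩ := hy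
  refine ⟨a * d + c * b, b * d, by push_cast; exact mul_ne_zero hb hd, ?_, ?_⟩
  · push_cast; rw [← h1, ← h3]; ring
  · push_cast; rw [h2, h4]; ring

theorem mul {x y : ℚ} {r s : ZMod p} (hx : HasResidue p x r) (hy : HasResidue p y s) :
    HasResidue p (x * y) (r * s) := by
  obtain ⟨a, b, hb, h1, h2⟩ := hx
  obtain ⟨c, d, hd, h3, h4⟩ := hy
  refine ⟨a * c, b * d, by push_cast; exact mul_ne_zero hb hd, ?_, ?_⟩
  · push_cast; rw [← h1, ← h3]; ring
  · push_cast; rw [h2, h4]; ring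

theorem pow {x : ℚ} {r : ZMod p} (hx : HasResidue p x r) (k : ℕ) :
    HasResidue p (x ^ k) (r ^ k) := by
  induction k with
  | zero => simpa using intCast (p := p) 1
  | succ k ih => simpa only [pow_succ] using ih.mul hx

theorem inv {x : ℚ} {r : ZMod p} (hx : HasResidue p x r) (hr : r ≠ 0) :
    HasResidue p x⁻¹ r⁻¹ := by
  obtain ⟨a, b, hb, h1, h2⟩ := hx
  have ha : (a : ZMod p) ≠ 0 := h2 ▸ mul_ne_zero hr hb
  have hx0 : x ≠ 0 := by
    rintro rfl
    rw [zero_mul] at h1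
    have : a = 0 := by exact_mod_cast h1.symm
    simp [this] at ha
  refine ⟨b, a, ha, ?_, ?_⟩
  · rw [← h1, inv_mul_cancel_left₀ hx0]
  · rw [h2, inv_mul_cancel_left₀ hr]

theorem sum {f : ℕ → ℚ} {g : ℕ → ZMod p} {s : Finset ℕ}
    (h : ∀ k ∈ s, HasResidue p (f k) (g k)) : HasResidue p (∑ k ∈ s, f k) (∑ k ∈ s, g k) := by
  induction s using Finset.cons_induction with
  | empty => simpa using intCast (p := p) 0
  | cons a s ha ih =>
    rw [Finset.sum_cons, Finset.sum_cons]
    exact (h a (Finset.mem_cons_self a s)).add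
      (ih fun k hk => h k (Finset.mem_cons_of_mem hk))

theorem ratModEq {x y : ℚ} {r : ZMod p} (hx : HasResidue p x r) (hy : HasResidue p y r) :
    RatModEq p x y := by
  obtain ⟨a, b, hb, h1, h2⟩ := hx
  obtain ⟨c, d, hd, h3, h4⟩ := hy
  have hbd : ((b * d : ℤ) : ZMod p) ≠ 0 := by push_cast; exact mul_ne_zero hb hd
  obtain ⟨e, he⟩ : (p : ℤ) ∣ a * d - c * b := by
    rw [← ZMod.intCast_zmod_eq_zero_iff_dvd]
    push_cast; rw [h2, h4]; ring
  have hbd0 : ((b * d : ℤ) : ℚ) ≠ 0 := by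
    intro h0
    have : b * d = 0 := by exact_mod_cast h0
    rw [this] at hbd
    simp at hbd
  refine ⟨isPIntegral_of_mul_eq hb h1, isPIntegral_of_mul_eq hd h3, e / (b * d : ℤ),
    isPIntegral_of_mul_eq hbd (div_mul_cancel₀ _ hbd0), ?_⟩
  rw [← mul_div_assoc, eq_div_iff hbd0]
  have he' : (a : ℚ) * d - c * b = p * e := by exact_mod_cast he
  rw [← he', ← h1, ← h3]
  push_cast
  ring

end HasResidue

theorem succ_mul_ringChoose_succ (r : ℚ) (k : ℕ) :
    ((k : ℚ) + 1) * Ring.choose r (k + 1) = Ring.choose r k * (r - k) := by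
  have h1 := Ring.descPochhammer_eq_factorial_smul_choose r (k + 1)
  rw [descPochhammer_succ_right, Polynomial.smeval_mul,
    Ring.descPochhammer_eq_factorial_smul_choose] at h1
  simp only [Polynomial.smeval_sub, Polynomial.smeval_X, Polynomial.smeval_natCast, pow_zero,
    pow_one, nsmul_eq_mul, mul_one, Nat.factorial_succ] at h1
  push_cast at h1
  have hk : (k.factorial : ℚ) ≠ 0 := by exact_mod_cast k.factorial_ne_zero
  refine mul_left_cancel₀ hk ?_
  linear_combination -h1

theorem hasResidue_ringChoose {n k : ℕ} (hn : (3 : ZMod p) * n = -1) (hk : k < p) :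
    HasResidue p (Ring.choose (-1 / 3 : ℚ) k) (n.choose k : ZMod p) := by
  have h3 : (3 : ZMod p) ≠ 0 := by
    intro h; rw [h, zero_mul] at hn
    exact one_ne_zero (neg_eq_zero.1 hn.symm)
  induction k with
  | zero => simpa using HasResidue.intCast (p := p) 1
  | succ k ih =>
    have hk0 : (((k + 1 : ℕ) : ℤ) : ZMod p) ≠ 0 := by
      exact_mod_cast ZMod.natCast_ne_zero_of_lt k.succ_pos hk
    have e1 : Ring.choose (-1 / 3 : ℚ) (k + 1) =
        Ring.choose (-1 / 3 : ℚ) k * (((-1 - 3 * k : ℤ) : ℚ) * ((3 : ℤ) : ℚ)⁻¹) *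
          (((k + 1 : ℕ) : ℤ) : ℚ)⁻¹ := by
      have hq : (k : ℚ) + 1 ≠ 0 := by positivity
      rw [← div_eq_mul_inv (_ * _), eq_div_iff (by exact_mod_cast hq)]
      have := succ_mul_ringChoose_succ (-1 / 3) k
      push_cast
      linear_combination this
    have e2 : (n.choose (k + 1) : ZMod p) =
        n.choose k * (((-1 - 3 * k : ℤ) : ZMod p) * ((3 : ℤ) : ZMod p)⁻¹) *
          (((k + 1 : ℕ) : ℤ) : ZMod p)⁻¹ := by
      rw [← div_eq_mul_inv (_ * _), eq_div_iff hk0]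
      have h1 : (n.choose (k + 1) : ZMod p) * (k + 1) = n.choose k * (n - k) :=
        natCast_choose_succ_mul n k
      have h4 : ((-1 - 3 * k : ℤ) : ZMod p) * ((3 : ℤ) : ZMod p)⁻¹ = n - k := by
        push_cast
        rw [← div_eq_mul_inv, div_eq_iff h3]
        linear_combination -hn
      rw [h4, ← h1]
      push_cast
      ring
    rw [e1, e2]
    exact ((ih (by omega)).mul ((HasResidue.intCast _).mul
      ((HasResidue.intCast 3).inv (by exact_mod_cast h3)))).mul ((HasResidue.intCast _).inv hk0)

end Reduction

theorem theorem6p1 (p : ℕ) (hp : p.Prime) (hp3 : 3 < p) :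
    RatModEq p
        (∑ k ∈ Finset.range p, (Ring.choose (-1 / 3 : ℚ) k) ^ 2 * (9 : ℚ) ^ k)
        (1 / (3 : ℚ) ^ (p / 3) *
          ∑ k ∈ Finset.range p, (Ring.choose (-1 / 3 : ℚ) k) ^ 2 * (1 / (9 : ℚ) ^ k)) ∧
    (∀ L M : ℤ, p % 3 = 1 → 4 * (p : ℤ) = L ^ 2 + 27 * M ^ 2 → (3 : ℤ) ∣ L - 2 →
      RatModEq p
        (1 / (3 : ℚ) ^ (p / 3) *
          ∑ k ∈ Finset.range p, (Ring.choose (-1 / 3 : ℚ) k) ^ 2 * (1 / (9 : ℚ) ^ k))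
        (L : ℚ)) ∧
    (p % 3 = 2 →
      RatModEq p
        (1 / (3 : ℚ) ^ (p / 3) *
          ∑ k ∈ Finset.range p, (Ring.choose (-1 / 3 : ℚ) k) ^ 2 * (1 / (9 : ℚ) ^ k))
        0) := by
  have : Fact p.Prime := ⟨hp⟩
  have h3 := ZMod.three_ne_zero_of_three_lt hp3
  have h9 : (9 : ZMod p) ≠ 0 := by
    rw [show (9 : ZMod p) = 3 ^ 2 by norm_num]; exact pow_ne_zero _ h3
  have r3 : HasResidue p 3 (3 : ZMod p) := by exact_mod_cast HasResidue.intCast (p := p) 3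
  have r9 : HasResidue p 9 (9 : ZMod p) := by exact_mod_cast HasResidue.intCast (p := p) 9
  have hleft : ∀ n : ℕ, (3 : ZMod p) * n = -1 → HasResidue p
      (∑ k ∈ Finset.range p, (Ring.choose (-1 / 3 : ℚ) k) ^ 2 * (9 : ℚ) ^ k)
      (∑ k ∈ Finset.range p, (n.choose k : ZMod p) ^ 2 * 9 ^ k) := fun n hn =>
    HasResidue.sum fun k hk =>
      ((hasResidue_ringChoose hn (Finset.mem_range.1 hk)).pow 2).mul (r9.pow k)
  have hright : ∀ n : ℕ, (3 : ZMod p) * n = -1 → HasResidue p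
      (1 / (3 : ℚ) ^ (p / 3) *
        ∑ k ∈ Finset.range p, (Ring.choose (-1 / 3 : ℚ) k) ^ 2 * (1 / (9 : ℚ) ^ k))
      (((3 : ZMod p) ^ (p / 3))⁻¹ *
        ∑ k ∈ Finset.range p, (n.choose k : ZMod p) ^ 2 * (9 ^ k)⁻¹) := by
    intro n hn
    simp only [one_div]
    exact ((r3.pow _).inv (pow_ne_zero _ h3)).mul (HasResidue.sum fun k hk =>
      ((hasResidue_ringChoose hn (Finset.mem_range.1 hk)).pow 2).mul
        ((r9.pow k).inv (pow_ne_zero _ h9)))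
  have hmod : p % 3 = 1 ∨ p % 3 = 2 := by
    have h0 : ¬ 3 ∣ p := fun h => by
      have := (Nat.prime_dvd_prime_iff_eq Nat.prime_three hp).1 h
      omega
    omega
  rcases hmod with h1 | h2
  · obtain ⟨n, hpn⟩ : ∃ n, p = 3 * n + 1 := ⟨p / 3, by omega⟩
    have hdiv : p / 3 = n := by omega
    have hn : (3 : ZMod p) * n = -1 := by
      have h := ZMod.natCast_self p
      rw [congrArg (Nat.cast (R := ZMod p)) hpn] at h
      push_cast at h
      linear_combination h
    have hpow : ∀ c : ZMod p, c ≠ 0 → (c ^ 3) ^ n = 1 := fun c hc => by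
      rw [← pow_mul, show 3 * n = p - 1 by omega]
      exact ZMod.pow_card_sub_one_eq_one hc
    have hS := sum_choose_sq_mul_nine_pow hp3 (by omega) hn
    have hrev := sum_choose_sq_mul_pow_reverse (p := p) (n := n) (by omega) h9
    have h93 : (9 : ZMod p) ^ n = (3 ^ (p / 3))⁻¹ := by
      rw [hdiv]
      refine eq_inv_of_mul_eq_one_left ?_
      rw [← mul_pow, ← hpow 3 h3]
      norm_num
    rw [h93] at hrev
    have hR := hright n hn
    have hLft := hleft n hn
    rw [hrev] at hLft
    refine ⟨hLft.ratModEq hR, fun L M _ hLM hL => hR.ratModEq ?_, fun h => by omega⟩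
    obtain ⟨A, B, hAB, hA, hAW⟩ := exists_four_mul_prime_eq_sq_add hpn
    have h8 : (8 : ZMod p) ^ n = 1 := by rw [← hpow 2 (ZMod.two_ne_zero_of_three_lt hp3)]; norm_num
    rw [← hrev, hS, h8, sum_hesse_pow_of_eq_three_mul_add_one hpn, ← hAW, neg_one_mul,
      ← Int.cast_neg, ← eq_neg_of_four_mul_prime_eq hLM hAB hL hA]
    exact HasResidue.intCast L
  · obtain ⟨n, hpn⟩ : ∃ n, 2 * p = 3 * n + 1 := ⟨(2 * p - 1) / 3, by omega⟩
    have hn : (3 : ZMod p) * n = -1 := by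
      have h := congrArg (Nat.cast (R := ZMod p)) hpn
      push_cast at h
      rw [ZMod.natCast_self] at h
      linear_combination -h
    have hS := sum_choose_sq_mul_nine_pow hp3 (by omega) hn
    rw [sum_hesse_pow_of_mod_three_eq_two hp3 h2, mul_zero] at hS
    have hrev := sum_choose_sq_mul_pow_reverse (p := p) (n := n) (by omega) h9
    rw [hS] at hrev
    have hR := hright n hn
    have hLft := hleft n hn
    rw [(mul_eq_zero.1 hrev.symm).resolve_left (pow_ne_zero _ h9), mul_zero] at hR
    rw [hS] at hLft
    exact ⟨hLft.ratModEq hR, fun _ _ h => by omega, fun _ =>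
      hR.ratModEq (by exact_mod_cast HasResidue.intCast (p := p) 0)⟩
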